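/- Let $\mathcal K$ be a locally small (ordinary) category, possibly with a large class of objects. A functor $F:\mathcal K^{\mathrm{op}}\to\mathbf{Set}$ is called \emph{small} if it is the left Kan extension of its restriction to some small full subcategory of $\mathcal K^{\mathrm{op}}$. Let $\mathcal P\mathcal K$ be the category of small functors $\mathcal K^{\mathrm{op}}\to\mathbf{Set}$ and all natural transformations between them. Then $\mathcal P\mathcal K$ is complete (has all small limits) if and only if, for every small category $\mathcal D$ and every functor $S:\mathcal D\to\mathcal K$, there is a small set of cones $(\beta_i:\Delta B_i\to S)_{i\in I}$ such that every cone $\alpha:\Delta A\to S$ factorizes through one of them, i.e. $\alpha=\beta_i\cdot\Delta f$ for some $i\in I$ and some $f:A\to B_i$. -/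

import Mathlib

open CategoryTheory CategoryTheory.Limits

universe v u

/-- A functor `F : C ⥤ Type v` is small if it is the (pointwise) left Kan extension of its
restriction to some small full subcategory of `C`, the unit of the extension being the identity. -/
def IsSmallFunctor {C : Type u} [Category.{v} C] (F : C ⥤ Type v) : Prop :=
  ∃ P : ObjectProperty C, ObjectProperty.Small.{v} P ∧
    Nonempty (Functor.LeftExtension.mk F (𝟙 (P.ι ⋙ F))).IsPointwiseLeftKanExtension

/-- The property of presheaves on `K` of being small. -/
def smallPresheafProperty (K : Type u) [Category.{v} K] : ObjectProperty (Kᵒᵖ ⥤ Type v) :=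
  fun F => IsSmallFunctor F

/-- The category of small presheaves on `K`, with all natural transformations as morphisms. -/
abbrev SmallPresheaf (K : Type u) [Category.{v} K] :=
  (smallPresheafProperty K).FullSubcategory

/-!
A presheaf on `K` is *petty* if it is a quotient of a small coproduct of representables, that is,
if all its elements are restrictions of a small set of generators. A presheaf is small exactly when
it is petty and its generators can be chosen such that the pullbacks `yoneda p ×_F yoneda q` of
any two of them are petty too: generators and relations both need small generating sets
(`isSmallFunctor_of_spanCovers`, `IsSmallFunctor.exists_presentation`).

If the category of small presheaves has limits, then by the Yoneda lemma the limit of the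
representables `yoneda (S d)` has as its elements over `A` the cones over `S` with vertex `A`. This
limit is small, hence petty, and its generators form a solution set for cones
(`exists_solutionSet_of_hasLimitsOfSize`).

Conversely, assume the solution set condition. Equality of restrictions of two generators of a small
presheaf is witnessed by finite zigzags. Covers by small sets of spans compose, by the solution
sets of cospans, so all pullbacks of representables over a small presheaf `F` are petty
(`IsSmallFunctor.spanCovers`). Now let `L` be a pointwise limit of small presheaves `G d`. An
element of `L` consists of a restriction of a generator of `G d` for each `d`, and its
compatibility with an arrow `d ⟶ d'` means factoring through one of a small set of spans. Once
generators and spans are chosen, for which there is only a small set of possibilities, what remains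
is a cone over a small diagram in `K`, so that `L` is petty. Likewise, two morphisms identify given
elements of `L` if and only if they do so in each component, hence if and only if they extend to
a cone over a family of spans, so that the relations are petty too. Therefore `L` is small
(`isClosedUnderLimitsOfShape`).
All diagrams needed here are families of spans between families of objects
(`HasMultispanSolutionSets`).
-/

open Opposite

variable {K : Type u} [Category.{v} K]

/-! ### Generating sets of elements and covers by spans -/

/-- A presheaf `F` is petty if it has a small set of elements of which every element of `F` is
a restriction, i.e. if `F` is a quotient of a small coproduct of representables. -/
def IsPetty (F : Kᵒᵖ ⥤ Type v) : Prop :=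
  ∃ (ι : Type v) (B : ι → K) (x : ∀ i, F.obj (op (B i))),
    ∀ (A : K) (a : F.obj (op A)), ∃ (i : ι) (f : A ⟶ B i), F.map f.op (x i) = a

/-- For elements `x ∈ F p` and `y ∈ F q`, a relation `ρ` between morphisms into `p` and morphisms
into `q` is covered if there is a small set of spans from `p` to `q`, each of them equalizing `x`
and `y`, such that any pair related by `ρ` factors through one of these spans. When `ρ` is the
relation `F f x = F g y` this says that the pullback of `x : yoneda p ⟶ F` and
`y : yoneda q ⟶ F` is petty. -/
def SpanCovers (F : Kᵒᵖ ⥤ Type v) {p q : K} (x : F.obj (op p)) (y : F.obj (op q))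
    (ρ : ∀ A : K, (A ⟶ p) → (A ⟶ q) → Prop) : Prop :=
  ∃ (ι : Type v) (C : ι → K) (a : ∀ i, C i ⟶ p) (b : ∀ i, C i ⟶ q),
    (∀ i, F.map (a i).op x = F.map (b i).op y) ∧
    ∀ (A : K) (f : A ⟶ p) (g : A ⟶ q), ρ A f g → ∃ (i : ι) (w : A ⟶ C i), w ≫ a i = f ∧ w ≫ b i = g

lemma map_comp_eq_of_map_eq {F : Kᵒᵖ ⥤ Type v} {A C p q : K} {x : F.obj (op p)} {y : F.obj (op q)}
    {a : C ⟶ p} {b : C ⟶ q} (h : F.map a.op x = F.map b.op y) (w : A ⟶ C) :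
    F.map (w ≫ a).op x = F.map (w ≫ b).op y := by
  simp only [op_comp, Functor.map_comp, comp_apply, h]

/-- The solution set condition for cones over diagrams given by small families of objects
`p r` and spans `p (s l) ⟵ c l ⟶ p (t l)`, with the data of a cone spelled out. -/
def HasMultispanSolutionSets (K : Type u) [Category.{v} K] : Prop :=
  ∀ (L R : Type v) (s t : L → R) (c : L → K) (p : R → K)
    (a : ∀ l, c l ⟶ p (s l)) (b : ∀ l, c l ⟶ p (t l)),
    ∃ (ι : Type v) (B : ι → K) (f : ∀ i r, B i ⟶ p r) (w : ∀ i l, B i ⟶ c l),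
      (∀ i l, w i l ≫ a l = f i (s l)) ∧ (∀ i l, w i l ≫ b l = f i (t l)) ∧
      ∀ (A : K) (f' : ∀ r, A ⟶ p r) (w' : ∀ l, A ⟶ c l),
        (∀ l, w' l ≫ a l = f' (s l)) → (∀ l, w' l ≫ b l = f' (t l)) →
        ∃ (i : ι) (h : A ⟶ B i), (∀ r, h ≫ f i r = f' r) ∧ ∀ l, h ≫ w i l = w' l

/-- The solution set condition for cones over arbitrary small diagrams specializes to multispans. -/
lemma hasMultispanSolutionSets
    (H : ∀ (D : Type v) [SmallCategory D] (S : D ⥤ K),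
      ∃ (ι : Type v) (β : ι → Cone S), ∀ α : Cone S, ∃ i : ι, Nonempty (α ⟶ β i)) :
    HasMultispanSolutionSets K := by
  intro L R s t c p a b
  let J : MultispanShape.{v, v} := ⟨L, R, s, t⟩
  let I : MultispanIndex J K := ⟨c, p, a, b⟩
  obtain ⟨ι, β, hβ⟩ := H (WalkingMultispan J) I.multispan
  refine ⟨ι, fun i => (β i).pt, fun i r => (β i).π.app (.right r),
    fun i l => (β i).π.app (.left l), fun i l => (β i).w (WalkingMultispan.Hom.fst (J := J) l),
    fun i l => (β i).w (WalkingMultispan.Hom.snd (J := J) l), fun A f' w' ha hb => ?_⟩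
  let α : Cone I.multispan :=
    { pt := A
      π :=
        { app := fun x => match x with
            | .left l => w' l
            | .right r => f' r
          naturality := by
            rintro _ _ (_ | l | l)
            · simp
            · exact (Category.id_comp _).trans (ha l).symm
            · exact (Category.id_comp _).trans (hb l).symm } }
  obtain ⟨i, ⟨φ⟩⟩ := hβ α
  exact ⟨i, φ.hom, fun r => φ.w (.right r), fun l => φ.w (.left l)⟩

lemma HasMultispanSolutionSets.cospan (H : HasMultispanSolutionSets K) {p q r : K}
    (a : p ⟶ r) (b : q ⟶ r) :
    ∃ (ι : Type v) (B : ι → K) (f : ∀ i, B i ⟶ p) (g : ∀ i, B i ⟶ q),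
      (∀ i, f i ≫ a = g i ≫ b) ∧
      ∀ (A : K) (f' : A ⟶ p) (g' : A ⟶ q), f' ≫ a = g' ≫ b →
        ∃ (i : ι) (h : A ⟶ B i), h ≫ f i = f' ∧ h ≫ g i = g' := by
  -- The cospan is the multispan with the single object `r` and the two spans `(a, a)`, `(b, b)`.
  let c : ULift.{v} Bool → K := fun l => if l.down then p else q
  let m : ∀ l, c l ⟶ r := fun l => match l with
    | ⟨true⟩ => a
    | ⟨false⟩ => b
  obtain ⟨ι, B, f, w, hw, -, h⟩ := H (ULift.{v} Bool) PUnit.{v + 1} (fun _ => ⟨⟩) (fun _ => ⟨⟩)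
    c (fun _ => r) m m
  refine ⟨ι, B, fun i => w i ⟨true⟩, fun i => w i ⟨false⟩,
    fun i => (hw i ⟨true⟩).trans (hw i ⟨false⟩).symm, fun A f' g' e => ?_⟩
  let w' : ∀ l, A ⟶ c l := fun l => match l with
    | ⟨true⟩ => f'
    | ⟨false⟩ => g'
  have hw' : ∀ l, w' l ≫ m l = f' ≫ a := by
    rintro ⟨_ | _⟩
    · exact e.symm
    · rfl
  obtain ⟨i, k, -, hk⟩ := h A (fun _ => f' ≫ a) w' hw' hw'
  exact ⟨i, k, hk ⟨true⟩, hk ⟨false⟩⟩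

namespace SpanCovers

variable {F : Kᵒᵖ ⥤ Type v} {p q : K} {x : F.obj (op p)} {y : F.obj (op q)}
  {ρ σ : ∀ A : K, (A ⟶ p) → (A ⟶ q) → Prop}

lemma mono (h : SpanCovers F x y σ) (hρ : ∀ A f g, ρ A f g → σ A f g) : SpanCovers F x y ρ := by
  obtain ⟨ι, C, a, b, hab, hc⟩ := h
  exact ⟨ι, C, a, b, hab, fun A f g hfg => hc A f g (hρ A f g hfg)⟩

lemma symm (h : SpanCovers F x y ρ) : SpanCovers F y x (fun A g f => ρ A f g) := by
  obtain ⟨ι, C, a, b, hab, hc⟩ := h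
  refine ⟨ι, C, b, a, fun i => (hab i).symm, fun A f g hfg => ?_⟩
  obtain ⟨i, w, h₁, h₂⟩ := hc A g f hfg
  exact ⟨i, w, h₂, h₁⟩

/-- The graph of a morphism `h` with `F h y = x` is covered by the span `(𝟙, h)`. -/
lemma of_map_eq (x : F.obj (op p)) (y : F.obj (op q)) :
    SpanCovers F x y
      (fun _ f g => ∃ h : p ⟶ q, F.map h.op y = x ∧ f ≫ h = g) :=
  ⟨{h : p ⟶ q // F.map h.op y = x}, fun _ => p, fun _ => 𝟙 p, fun h => h.1,
    fun h => by simpa using h.2.symm,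
    fun _ f _ ⟨h, e, e'⟩ => ⟨⟨h, e⟩, f, Category.comp_id f, e'⟩⟩

lemma iUnion {ρ : ℕ → ∀ A : K, (A ⟶ p) → (A ⟶ q) → Prop} (h : ∀ n, SpanCovers F x y (ρ n)) :
    SpanCovers F x y (fun A f g => ∃ n, ρ n A f g) := by
  choose ι C a b hab hc using h
  refine ⟨Σ n, ι n, fun i => C i.1 i.2, fun i => a i.1 i.2, fun i => b i.1 i.2,
    fun i => hab i.1 i.2, ?_⟩
  rintro A f g ⟨n, hn⟩
  obtain ⟨i, w, h₁, h₂⟩ := hc n A f g hn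
  exact ⟨⟨n, i⟩, w, h₁, h₂⟩

lemma or (h₁ : SpanCovers F x y ρ) (h₂ : SpanCovers F x y σ) :
    SpanCovers F x y (fun A f g => ρ A f g ∨ σ A f g) := by
  refine (iUnion (ρ := fun n => if n = 0 then ρ else σ) fun n => ?_).mono
    fun A f g h => h.elim (fun h => ⟨0, h⟩) fun h => ⟨1, h⟩
  split_ifs
  exacts [h₁, h₂]

/-- Covered relations compose, through a small set of intermediate elements: two composable
spans are covered by the solution set of the cospan in their middle. -/
lemma comp (H : HasMultispanSolutionSets K) {J : Type*} [Small.{v} J] {r : J → K}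
    {z : ∀ j, F.obj (op (r j))} {ρ : ∀ j (A : K), (A ⟶ p) → (A ⟶ r j) → Prop}
    {σ : ∀ j (A : K), (A ⟶ r j) → (A ⟶ q) → Prop}
    (hρ : ∀ j, SpanCovers F x (z j) (ρ j)) (hσ : ∀ j, SpanCovers F (z j) y (σ j)) :
    SpanCovers F x y (fun A f g => ∃ j h, ρ j A f h ∧ σ j A h g) := by
  choose ι C a b hab hc using hρ
  choose ι' C' a' b' hab' hc' using hσ
  choose κ B f g hfg hB using fun j (i : ι j) (i' : ι' j) => H.cospan (b j i) (a' j i')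
  let e := (equivShrink.{v} J).symm
  refine ⟨Σ (s : Shrink.{v} J) (i : ι (e s)) (i' : ι' (e s)), κ (e s) i i',
    fun k => B _ _ _ k.2.2.2, fun k => f _ _ _ k.2.2.2 ≫ a _ k.2.1,
    fun k => g _ _ _ k.2.2.2 ≫ b' _ k.2.2.1, ?_, ?_⟩
  · rintro ⟨s, i, i', k⟩
    have h₁ : F.map (f _ i i' k ≫ b _ i).op (z (e s)) =
        F.map (g _ i i' k ≫ a' _ i').op (z (e s)) := by
      rw [hfg]
    simp only [op_comp, Functor.map_comp, comp_apply] at h₁ ⊢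
    rw [hab, h₁, hab']
  · rintro A u w ⟨j, h, h₁, h₂⟩
    obtain ⟨s, rfl⟩ := e.surjective j
    obtain ⟨i, m, rfl, hm⟩ := hc _ A _ _ h₁
    obtain ⟨i', m', hm', rfl⟩ := hc' _ A _ _ h₂
    obtain ⟨k, n, rfl, rfl⟩ := hB _ i i' A m m' (hm.trans hm'.symm)
    exact ⟨⟨s, i, i', k⟩, n, by simp, by simp⟩

end SpanCovers

/-! ### Small presheaves in terms of elements -/

lemma coconeAt_mk_id_apply {C : Type u} [Category.{v} C] (F : C ⥤ Type v) (P : ObjectProperty C)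
    {X : C} (c : CostructuredArrow P.ι X) (y : F.obj c.left.obj) :
    ((Functor.LeftExtension.mk F (𝟙 (P.ι ⋙ F))).coconeAt X).ι.app c y = F.map c.hom y :=
  ConcreteCategory.congr_hom (Category.id_comp (F.map c.hom)) y

/-- A petty presheaf with petty equality is a small functor: it is the left Kan extension of its
restriction to the full subcategory spanned by the generators and by the vertices of the spans
that cover the relations between them. -/
theorem isSmallFunctor_of_spanCovers {F : Kᵒᵖ ⥤ Type v} {ι : Type v} {B : ι → K}
    (x : ∀ i, F.obj (op (B i)))
    (hx : ∀ (A : K) (a : F.obj (op A)), ∃ (i : ι) (f : A ⟶ B i), F.map f.op (x i) = a)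
    (hx' : ∀ i j, SpanCovers F (x i) (x j) (fun _ f g => F.map f.op (x i) = F.map g.op (x j))) :
    IsSmallFunctor F := by
  choose κ C a b hab hC using hx'
  let V : ι ⊕ (Σ i j, κ i j) → Kᵒᵖ := Sum.elim (fun i => op (B i)) (fun k => op (C _ _ k.2.2))
  let P : ObjectProperty Kᵒᵖ := .ofObj V
  let gen (i : ι) : P.FullSubcategory := ⟨op (B i), ObjectProperty.ofObj_apply V (.inl i)⟩
  let rel (i j : ι) (k : κ i j) : P.FullSubcategory :=
    ⟨op (C i j k), ObjectProperty.ofObj_apply V (.inr ⟨i, j, k⟩)⟩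
  refine ⟨P, inferInstance, ⟨fun X => ?_⟩⟩
  let Φ := CostructuredArrow.proj P.ι X ⋙ P.ι ⋙ F
  have wφ (s : Cocone Φ) {Y Z : P.FullSubcategory} (g : Y ⟶ Z) (h : Z.obj ⟶ X) (y : F.obj Y.obj) :
      s.ι.app (CostructuredArrow.mk (S := P.ι) (Y := Z) h) (F.map g.hom y) =
        s.ι.app (CostructuredArrow.mk (S := P.ι) (Y := Y) (g.hom ≫ h)) y :=
    ConcreteCategory.congr_hom
      (s.w (CostructuredArrow.homMk (f := CostructuredArrow.mk (S := P.ι) (Y := Y) (g.hom ≫ h))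
        (f' := CostructuredArrow.mk (S := P.ι) (Y := Z) h) g rfl)) y
  -- The value of a cocone on a restriction of a generator depends only on the restricted element.
  have key (s : Cocone Φ) (i j : ι) (f : X.unop ⟶ B i) (g : X.unop ⟶ B j)
      (e : F.map f.op (x i) = F.map g.op (x j)) :
      s.ι.app (CostructuredArrow.mk (S := P.ι) (Y := gen i) f.op) (x i) =
        s.ι.app (CostructuredArrow.mk (S := P.ι) (Y := gen j) g.op) (x j) := by
    obtain ⟨k, w, rfl, rfl⟩ := hC i j X.unop f g e
    have h₁ := wφ s (Y := gen i) (Z := rel i j k) (ObjectProperty.homMk (a i j k).op) w.op (x i)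
    have h₂ := wφ s (Y := gen j) (Z := rel i j k) (ObjectProperty.homMk (b i j k).op) w.op (x j)
    exact h₁.symm.trans ((congrArg _ (hab i j k)).trans h₂)
  choose i f hf using hx
  refine
    { desc := fun s => ↾fun y =>
        s.ι.app (CostructuredArrow.mk (S := P.ι) (Y := gen (i X.unop y)) (f X.unop y).op) (x _)
      fac := fun s c => ?_
      uniq := fun s m hm => ?_ }
  · ext y
    obtain ⟨Y, h, rfl⟩ := CostructuredArrow.mk_surjective c
    change Y.obj ⟶ X at h
    change F.obj Y.obj at y
    have h₁ := wφ s (Y := gen (i Y.obj.unop y)) (Z := Y)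
      (ObjectProperty.homMk (f Y.obj.unop y).op) h (x _)
    have h₂ := key s _ _ (f X.unop (F.map h y)) (h.unop ≫ f Y.obj.unop y) (by
      rw [hf]
      simp only [op_comp, Functor.map_comp, comp_apply]
      rw [hf]
      rfl)
    have h₃ : F.map (f Y.obj.unop y).op (x _) = y := hf Y.obj.unop y
    have h₄ := (congrArg (s.ι.app (CostructuredArrow.mk h)) h₃).symm.trans h₁
    refine Eq.trans ?_ (h₂.trans h₄.symm)
    exact congrArg (fun y => s.ι.app (CostructuredArrow.mk (S := P.ι) (Y := gen (i X.unop y))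
      (f X.unop y).op) (x (i X.unop y))) (coconeAt_mk_id_apply F P (CostructuredArrow.mk h) y)
  · ext y
    have h := ConcreteCategory.congr_hom
      (hm (CostructuredArrow.mk (S := P.ι) (Y := gen (i X.unop y)) (f X.unop y).op)) (x _)
    exact (congrArg m ((coconeAt_mk_id_apply F P _ _).trans (hf X.unop y))).symm.trans h

/-- The unit of the Kan extension presents a small functor by generators and relations: the
elements over the small subcategory generate, and two restrictions of generators agree only if
they are connected by a zigzag of morphisms of elements. The objects of the small subcategory live
in the universe of the objects of `K`, hence the index type is merely `v`-small. -/
theorem IsSmallFunctor.exists_presentation {F : Kᵒᵖ ⥤ Type v} (hF : IsSmallFunctor F) :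
    ∃ (J : Type (max u v)) (_ : Small.{v} J) (p : J → K) (x : ∀ j, F.obj (op (p j))),
      (∀ (A : K) (a : F.obj (op A)), ∃ (j : J) (f : A ⟶ p j), F.map f.op (x j) = a) ∧
      ∀ (A : K) (s t : Σ j, A ⟶ p j), F.map s.2.op (x s.1) = F.map t.2.op (x t.1) →
        Relation.EqvGen (fun s t : Σ j, A ⟶ p j =>
          ∃ h : p t.1 ⟶ p s.1, F.map h.op (x s.1) = x t.1 ∧ t.2 ≫ h = s.2) s t := by
  obtain ⟨P, hP, ⟨hF⟩⟩ := hF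
  refine ⟨Σ j : Subtype P, F.obj j.1, inferInstance, fun j => j.1.1.unop, fun j => j.2,
    fun A a => ?_, fun A s t hst => ?_⟩
  · obtain ⟨c, y, hy⟩ := Types.jointly_surjective_of_isColimit (hF (op A)) a
    refine ⟨⟨⟨c.left.obj, c.left.property⟩, y⟩, c.hom.unop, ?_⟩
    exact (coconeAt_mk_id_apply F P c y).symm.trans hy
  · have hc := (Types.isColimit_iff_coconeTypesIsColimit _).1 ⟨hF (op A)⟩
    let m (s : Σ j : (Σ j : Subtype P, F.obj j.1), A ⟶ j.1.1.unop) :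
        CostructuredArrow P.ι (op A) :=
      CostructuredArrow.mk (S := P.ι) (Y := (⟨s.1.1.1, s.1.1.2⟩ : P.FullSubcategory)) s.2.op
    have e := (coconeAt_mk_id_apply F P (m s) s.1.2).trans
      (hst.trans (coconeAt_mk_id_apply F P (m t) t.1.2).symm)
    let Φ := CostructuredArrow.proj P.ι (op A) ⋙ P.ι ⋙ F
    have h : Φ.ιColimitType (m s) s.1.2 = Φ.ιColimitType (m t) t.1.2 := hc.bijective.1 e
    let ψ (c : Σ c, Φ.obj c) :
        Σ j : (Σ j : Subtype P, F.obj j.1), A ⟶ j.1.1.unop :=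
      ⟨⟨⟨c.1.left.obj, c.1.left.property⟩, c.2⟩, c.1.hom.unop⟩
    let R (s t : Σ j : (Σ j : Subtype P, F.obj j.1), A ⟶ j.1.1.unop) : Prop :=
      ∃ h : t.1.1.1.unop ⟶ s.1.1.1.unop, F.map h.op s.1.2 = t.1.2 ∧ t.2 ≫ h = s.2
    have hψ : ∀ c c', Relation.EqvGen Φ.ColimitTypeRel c c' →
        Relation.EqvGen R (ψ c) (ψ c') := by
      intro c c' h
      induction h with
      | rel c c' h =>
        obtain ⟨φ, hφ⟩ := h
        refine .rel _ _ ⟨φ.left.hom.unop, hφ.symm, ?_⟩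
        have := CostructuredArrow.w φ
        exact Quiver.Hom.op_inj this
      | refl c => exact .refl _
      | symm c c' _ h => exact .symm _ _ h
      | trans c c' c'' _ _ h h' => exact .trans _ _ _ h h'
    exact hψ _ _ ((Functor.ιColimitType_eq_iff ..).1 h)

theorem IsSmallFunctor.isPetty {F : Kᵒᵖ ⥤ Type v} (hF : IsSmallFunctor F) : IsPetty F := by
  obtain ⟨J, _, p, x, hx, -⟩ := hF.exists_presentation
  let e := (equivShrink.{v} J).symm
  refine ⟨Shrink.{v} J, fun s => p (e s), fun s => x (e s), fun A a => ?_⟩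
  obtain ⟨j, h⟩ := hx A a
  obtain ⟨s, rfl⟩ := e.surjective j
  exact ⟨s, h⟩

/-- Pullbacks of representables over a small functor are petty. The zigzags of length `n` between
generators are covered by induction on `n`; arbitrary elements are restrictions of generators. -/
theorem IsSmallFunctor.spanCovers (H : HasMultispanSolutionSets K) {F : Kᵒᵖ ⥤ Type v}
    (hF : IsSmallFunctor F) {p q : K} (x : F.obj (op p)) (y : F.obj (op q)) :
    SpanCovers F x y (fun _ f g => F.map f.op x = F.map g.op y) := by
  obtain ⟨J, _, r, z, hz, hz'⟩ := hF.exists_presentation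
  let ρ (i j : J) (A : K) (f : A ⟶ r i) (g : A ⟶ r j) : Prop :=
    (∃ h : r i ⟶ r j, F.map h.op (z j) = z i ∧ f ≫ h = g) ∨
      ∃ h : r j ⟶ r i, F.map h.op (z i) = z j ∧ g ≫ h = f
  have hρ (i j : J) : SpanCovers F (z i) (z j) (ρ i j) :=
    (SpanCovers.of_map_eq _ _).or (SpanCovers.of_map_eq _ _).symm
  -- `chain n` relates the restrictions of generators joined by a zigzag of `n + 1` steps.
  let chain (n : ℕ) : ∀ (i j : J) (A : K), (A ⟶ r i) → (A ⟶ r j) → Prop :=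
    n.rec ρ fun _ c i j A f g => ∃ k h, c i k A f h ∧ ρ k j A h g
  have hchain (n : ℕ) (i j : J) : SpanCovers F (z i) (z j) (chain n i j) := by
    induction n generalizing i j with
    | zero => exact hρ i j
    | succ n ih => exact SpanCovers.comp H (fun k => ih i k) (fun k => hρ k j)
  have trans_chain {A : K} (s t : Σ j, A ⟶ r j) (n m : ℕ) (k : J) (h : A ⟶ r k)
      (h₁ : chain n s.1 k A s.2 h) (h₂ : chain m k t.1 A h t.2) :
      chain (n + m + 1) s.1 t.1 A s.2 t.2 := by
    induction m generalizing t with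
    | zero => exact ⟨k, h, h₁, h₂⟩
    | succ m ih =>
      obtain ⟨l, h', h₃, h₄⟩ := h₂
      exact ⟨l, h', ih ⟨l, h'⟩ h₃, h₄⟩
  have symm_ρ {A : K} {i j : J} {f : A ⟶ r i} {g : A ⟶ r j} (h : ρ i j A f g) : ρ j i A g f :=
    Or.symm h
  have symm_chain {A : K} (n : ℕ) (s t : Σ j, A ⟶ r j) (h : chain n s.1 t.1 A s.2 t.2) :
      chain n t.1 s.1 A t.2 s.2 := by
    induction n generalizing t with
    | zero => exact symm_ρ h
    | succ n ih =>
      obtain ⟨k, g, h₁, h₂⟩ := h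
      have := trans_chain t s 0 n k g (symm_ρ h₂) (ih ⟨k, g⟩ h₁)
      rwa [Nat.zero_add] at this
  have exists_chain {A : K} (s t : Σ j, A ⟶ r j)
      (h : F.map s.2.op (z s.1) = F.map t.2.op (z t.1)) :
      ∃ n, chain n s.1 t.1 A s.2 t.2 := by
    have h' := hz' A s t h
    clear h
    induction h' with
    | rel s t h => exact ⟨0, Or.inr h⟩
    | refl s => exact ⟨0, Or.inl ⟨𝟙 _, by simp, by simp⟩⟩
    | symm s t _ h => exact h.imp fun n hn => symm_chain n s t hn
    | trans s t w _ _ h₁ h₂ =>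
      obtain ⟨n, hn⟩ := h₁
      obtain ⟨m, hm⟩ := h₂
      exact ⟨n + m + 1, trans_chain s w n m t.1 t.2 hn hm⟩
  have hgen (i j : J) :
      SpanCovers F (z i) (z j) (fun _ f g => F.map f.op (z i) = F.map g.op (z j)) :=
    (SpanCovers.iUnion fun n => hchain n i j).mono
      fun A f g h => exists_chain ⟨i, f⟩ ⟨j, g⟩ h
  obtain ⟨i, a, rfl⟩ := hz p x
  obtain ⟨j, b, rfl⟩ := hz q y
  -- For `x = F a (z i)` and `y = F b (z j)`, the relation is the composite of the graph of `a`, the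
  -- relation for the generators `z i` and `z j`, and the converse of the graph of `b`.
  refine (SpanCovers.comp H (J := PUnit.{1}) (fun _ => SpanCovers.of_map_eq _ (z i)) fun _ =>
    SpanCovers.comp H (J := PUnit.{1}) (fun _ => hgen i j) fun _ =>
      (SpanCovers.of_map_eq _ _).symm).mono fun A f g h => ?_
  exact ⟨⟨⟩, f ≫ a, ⟨a, rfl, rfl⟩, ⟨⟩, g ≫ b, by simpa using h, b, rfl, rfl⟩

theorem isSmallFunctor_yoneda_obj (X : K) : IsSmallFunctor (yoneda.obj X) := by
  refine isSmallFunctor_of_spanCovers (ι := PUnit) (fun _ => 𝟙 X)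
    (fun A a => ⟨⟨⟩, a, Category.comp_id a⟩) fun _ _ => ?_
  refine (SpanCovers.of_map_eq _ _).mono fun A f g h => ⟨𝟙 X, by simp, ?_⟩
  simpa using h

/-! ### Limits of small presheaves -/

/-- Under the solution set condition, a small limit of small presheaves is small. An element of
the limit is a family of restrictions of generators, one for each object of the diagram, and its
compatibility is witnessed by factorizations through covering spans, one for each arrow; such
data are cones over one of a small set of multispans in `K`. -/
theorem isClosedUnderLimitsOfShape (H : HasMultispanSolutionSets K)
    (D : Type v) [SmallCategory D] :
    (smallPresheafProperty K).IsClosedUnderLimitsOfShape D := by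
  refine ⟨?_⟩
  rintro L ⟨pres⟩
  let G := pres.diag
  have hG (d : D) : IsSmallFunctor (G.obj d) := pres.prop_diag_obj d
  let π (d : D) : L ⟶ G.obj d := pres.π.app d
  have hlim (A : K) (s : ∀ d, (G.obj d).obj (op A))
      (hs : ∀ {d d' : D} (u : d ⟶ d'), (G.map u).app _ (s d) = s d') :
      ∃! a : L.obj (op A), ∀ d, (π d).app _ a = s d :=
    (Types.isLimit_iff _).1
      ⟨isLimitOfPreserves ((evaluation Kᵒᵖ (Type v)).obj (op A)) pres.isLimit⟩ s hs
  have hπ {A : K} (a : L.obj (op A)) {d d' : D} (u : d ⟶ d') :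
      (G.map u).app _ ((π d).app _ a) = (π d').app _ a :=
    (ConcreteCategory.congr_hom (NatTrans.congr_app (pres.π.naturality u) (op A)) a).symm
  have hext {A : K} (a b : L.obj (op A)) (h : ∀ d, (π d).app _ a = (π d).app _ b) : a = b :=
    (hlim A _ (hπ b)).unique h fun _ => rfl
  -- `i` chooses a generator for each object and `k` a covering span for each arrow of the diagram;
  -- a cone over the multispan of the chosen objects and spans yields a compatible family.
  have hpetty : IsPetty L := by
    choose ι B x hx using fun d => (hG d).isPetty
    choose κ C a b hab hC using fun (u : Σ d d' : D, d ⟶ d') (i : ι u.1) (j : ι u.2.1) =>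
      (hG u.2.1).spanCovers H ((G.map u.2.2).app _ (x u.1 i)) (x u.2.1 j)
    choose ν E f w ha hb hE using
      fun (i : ∀ d, ι d) (k : ∀ u : Σ d d' : D, d ⟶ d', κ u (i u.1) (i u.2.1)) =>
        H (Σ d d' : D, d ⟶ d') D (fun u => u.1) (fun u => u.2.1) (fun u => C u _ _ (k u))
          (fun d => B d (i d)) (fun u => a u _ _ (k u)) (fun u => b u _ _ (k u))
    have hcompat i k (n : ν i k) {d d' : D} (u : d ⟶ d') :
        (G.map u).app _ ((G.obj d).map (f i k n d).op (x d (i d))) =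
          (G.obj d').map (f i k n d').op (x d' (i d')) := by
      have h := map_comp_eq_of_map_eq (hab ⟨d, d', u⟩ _ _ (k _)) (w i k n ⟨d, d', u⟩)
      rw [ha, hb] at h
      rw [NatTrans.naturality_apply]
      exact h
    choose y hy using fun i k n => (hlim (E i k n) _ (hcompat i k n)).exists
    refine ⟨Σ i k, ν i k, fun n => E _ _ n.2.2, fun n => y _ _ n.2.2, fun A t => ?_⟩
    choose i g hg using fun d => hx d A ((π d).app _ t)
    have hspan (u : Σ d d' : D, d ⟶ d') := hC u (i u.1) (i u.2.1) A (g u.1) (g u.2.1) (by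
      dsimp only
      rw [← NatTrans.naturality_apply, hg, hg, hπ])
    choose k m hm hm' using hspan
    obtain ⟨n, h, hf, -⟩ := hE i k A g m hm hm'
    refine ⟨⟨i, k, n⟩, h, hext _ _ fun d => ?_⟩
    rw [NatTrans.naturality_apply, hy i k n d, ← hg d, ← comp_apply, ← Functor.map_comp, ← op_comp,
      hf d]
  -- Equality in the limit is equality in every component, so that a pair of morphisms identifying
  -- `x` and `y` is a cone over a family of covering spans, one for each component.
  have hcover {p q : K} (x : L.obj (op p)) (y : L.obj (op q)) :
      SpanCovers L x y (fun _ f g => L.map f.op x = L.map g.op y) := by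
    choose κ C a b hab hC using fun d => (hG d).spanCovers H ((π d).app _ x) ((π d).app _ y)
    -- The objects `p` and `q` of the multispan are indexed by booleans.
    choose ν E f w ha hb hE using fun k : ∀ d, κ d =>
      H D (ULift.{v} Bool) (fun _ => ⟨true⟩) (fun _ => ⟨false⟩) (fun d => C d (k d))
        (fun l => bif l.down then p else q) (fun d => a d (k d)) (fun d => b d (k d))
    refine ⟨Σ k, ν k, fun n => E _ n.2, fun n => f _ n.2 ⟨true⟩, fun n => f _ n.2 ⟨false⟩,
      ?_, fun A g h e => ?_⟩
    · rintro ⟨k, n⟩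
      refine hext _ _ fun d => ?_
      have h := map_comp_eq_of_map_eq (hab d (k d)) (w k n d)
      rw [ha, hb] at h
      rw [NatTrans.naturality_apply, NatTrans.naturality_apply]
      exact h
    · choose k m hm hm' using fun d => hC d A g h (by
        simpa only [NatTrans.naturality_apply] using congrArg ((π d).app (op A)) e)
      obtain ⟨n, l, hl, -⟩ := hE k A (fun l => match l with
        | ⟨true⟩ => g
        | ⟨false⟩ => h) m hm hm'
      exact ⟨⟨k, n⟩, l, hl ⟨true⟩, hl ⟨false⟩⟩
  obtain ⟨ι, B, x, hx⟩ := hpetty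
  exact isSmallFunctor_of_spanCovers x hx fun i j => hcover (x i) (x j)

/-- If the diagram of representables attached to `S` has a limit among small presheaves, then this
limit classifies cones over `S`, so that a small generating set of its elements is a solution set
for cones. -/
theorem exists_solutionSet_of_hasLimitsOfSize [HasLimitsOfSize.{v, v} (SmallPresheaf K)]
    (D : Type v) [SmallCategory D] (S : D ⥤ K) :
    ∃ (ι : Type v) (β : ι → Cone S), ∀ α : Cone S, ∃ i : ι, Nonempty (α ⟶ β i) := by
  -- The components at `𝟙` of natural transformations out of `yoneda.obj A` turn elements of
  -- the limit over `A` into cones with vertex `A`, and the universal property inverts this.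
  let y : K ⥤ SmallPresheaf K := (smallPresheafProperty K).lift yoneda isSmallFunctor_yoneda_obj
  let L := limit (S ⋙ y)
  let π (d : D) : L.obj ⟶ yoneda.obj (S.obj d) := (limit.π (S ⋙ y) d).hom
  have hπ {d d' : D} (u : d ⟶ d') : π d ≫ yoneda.map (S.map u) = π d' :=
    congrArg InducedCategory.Hom.hom (limit.w (S ⋙ y) u)
  obtain ⟨ι, B, x, hx⟩ := L.property.isPetty
  refine ⟨ι, fun i =>
    { pt := B i
      π :=
        { app := fun d => (π d).app (op (B i)) (x i)
          naturality := fun d d' u => ?_ } }, fun α => ?_⟩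
  · have := ConcreteCategory.congr_hom (NatTrans.congr_app (hπ u) (op (B i))) (x i)
    simpa using this.symm
  · let l : y.obj α.pt ⟶ L := limit.lift (S ⋙ y) (y.mapCone α)
    have hl (d : D) : l.hom ≫ π d = yoneda.map (α.π.app d) :=
      congrArg InducedCategory.Hom.hom (limit.lift_π (y.mapCone α) d)
    obtain ⟨i, f, hf⟩ := hx α.pt (l.hom.app (op α.pt) (𝟙 α.pt))
    refine ⟨i, ⟨{ hom := f, w := fun d => ?_ }⟩⟩
    have h₁ := ConcreteCategory.congr_hom (NatTrans.congr_app (hl d) (op α.pt)) (𝟙 α.pt)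
    have h₂ := NatTrans.naturality_apply (π d) f.op (x i)
    change (π d).app (op α.pt) (l.hom.app (op α.pt) (𝟙 α.pt)) = 𝟙 α.pt ≫ α.π.app d at h₁
    change _ = f ≫ (π d).app (op (B i)) (x i) at h₂
    rw [Category.id_comp, ← hf] at h₁
    exact h₂.symm.trans h₁

theorem mainTheorem6 (K : Type u) [Category.{v} K] :
    HasLimitsOfSize.{v, v} (SmallPresheaf K) ↔
      ∀ (D : Type v) [SmallCategory D] (S : D ⥤ K),
        ∃ (ι : Type v) (β : ι → Cone S),
          ∀ α : Cone S, ∃ i : ι, Nonempty (α ⟶ β i) := by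
  refine ⟨fun _ D _ S => exists_solutionSet_of_hasLimitsOfSize D S, fun H => ⟨fun D _ => ?_⟩⟩
  have := isClosedUnderLimitsOfShape (hasMultispanSolutionSets H) D
  infer_instance
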